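/- Let $m\ge 1$, let $\mathbf A\in\mathbb R^{m\times n}$ have rows $\mathbf a_1^{\mathsf T},\dots,\mathbf a_m^{\mathsf T}$ and columns $\mathbf A_1,\dots,\mathbf A_n$, let $\|\mathbf A\|_2$ be its spectral norm, and let $\Delta=\{\mathbf y\in\mathbb R^m : \mathbf 1^{\mathsf T}\mathbf y=1,\ \mathbf y\ge \mathbf 0\}$. Put $\operatorname{sgn}(t)=1$ for $t\ge 0$ and $\operatorname{sgn}(t)=-1$ for $t<0$, and let $\operatorname{Proj}_\Delta$ be the Euclidean projection onto $\Delta$. Let $\lambda\in\mathbb R$ and consider the alternating optimization algorithm for $$\min_{\mathbf x\in[-1,1]^n}\ \max_{\mathbf y\in\Delta}\ \mathbf y^{\mathsf T}\mathbf A\mathbf x-\lambda\|\mathbf x\|_1,$$ which, from an arbitrary starting point $(\mathbf x_1,\mathbf y_1)\in\mathbb R^n\times\mathbb R^m$, generates for $k=1,2,\dots$ $$\mathbf x_{k+1}(i)=\operatorname{sgn}(a_k^i)\min\Big\{|a_k^i|+\frac{\lambda}{\tau_k},\,1\Big\},\qquad a_k^i=\mathbf x_k(i)-\frac{\mathbf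 A_i^{\mathsf T}\mathbf y_k}{\tau_k},\qquad i=1,\dots,n,$$ $$\mathbf y_{k+1}=\operatorname{Proj}_\Delta\big(\mathbf y_k+\rho_k\mathbf A\mathbf x_{k+1}-\rho_kc_k\mathbf y_k\big).$$ Let the parameters be $\rho_k=\rho$, $c_k=\beta_1/k^{\gamma}$ and $\tau_k=\dfrac{16\beta_2\|\mathbf A\|_2^2}{\rho c_k^2}+\beta_3$, where $\beta_1>0$, $0<\rho\le 1/\beta_1$, $0<\gamma\le 0.5$, $\beta_2>1$, $\beta_3\ge\rho\|\mathbf A\|_2^2$, and $\beta_3>0$ (which is automatic if $\mathbf A\ne 0$). If $\lambda>\max_{l}\|\mathbf a_l\|_\infty$, then every limit point $\hat{\mathbf x}$ of $\{\mathbf x_k\}$ satisfies $\hat{\mathbf x}\in\{-1,1\}^n$. -/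

import Mathlib

open Filter Topology

namespace OneBit

/-- The sign of a real number, with the convention that the sign of `0` is `1`. -/
noncomputable def sgn (t : ℝ) : ℝ := if 0 ≤ t then 1 else -1

/-- The spectral norm `‖A‖₂`: the operator norm of `v ↦ A v` for the Euclidean norms. -/
noncomputable def specNorm {m n : ℕ} (A : Matrix (Fin m) (Fin n) ℝ) : ℝ :=
  ‖LinearMap.toContinuousLinearMap (Matrix.toLpLin 2 2 A)‖

/-- `max_l ‖a_l‖_∞`, where `a_l` is the `l`-th row of `A`. -/
noncomputable def maxRowNorm {m n : ℕ} (A : Matrix (Fin m) (Fin n) ℝ) : ℝ :=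
  ⨆ l : Fin m, ⨆ j : Fin n, |A l j|

/-- `p` is the projection of `v` onto `S` for the Euclidean norm. -/
def IsProj {m : ℕ} (S : Set (Fin m → ℝ)) (v p : Fin m → ℝ) : Prop :=
  p ∈ S ∧ ∀ w ∈ S, ‖WithLp.toLp 2 (v - p)‖ ≤ ‖WithLp.toLp 2 (v - w)‖

/-- The closed-form `x`-update: with `a_i = x_i - (A_iᵀ y) / τ`, where `A_i` is the `i`-th column
of `A`, the new `i`-th entry is `sgn(a_i) * min (|a_i| + lam / τ) 1`. -/
noncomputable def xUpdate {m n : ℕ} (A : Matrix (Fin m) (Fin n) ℝ) (lam τ : ℝ)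
    (x : Fin n → ℝ) (y : Fin m → ℝ) : Fin n → ℝ := fun i =>
  let a : ℝ := x i - (∑ l, A l i * y l) / τ
  sgn a * min (|a| + lam / τ) 1

/-- `(x k, y k)`, `k ≥ 1`, is a sequence of iterates of the alternating optimization algorithm for
`min_{x ∈ [-1,1]^n} max_{y ∈ Δ} yᵀ A x - lam ‖x‖₁`, where `Δ` is the standard simplex, with
parameters `τ k`, `ρ k`, `c k`. The iteration counter starts at `k = 1`, with an arbitrary starting
point; the values at index `0` play no role. -/
structure IsAOSequence {m n : ℕ} (A : Matrix (Fin m) (Fin n) ℝ) (lam : ℝ) (τ ρ c : ℕ → ℝ)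
    (x : ℕ → Fin n → ℝ) (y : ℕ → Fin m → ℝ) : Prop where
  x_step : ∀ k, 1 ≤ k → x (k + 1) = xUpdate A lam (τ k) (x k) (y k)
  y_step : ∀ k, 1 ≤ k → IsProj (stdSimplex ℝ (Fin m))
    (y k + ρ k • A.mulVec (x (k + 1)) - (ρ k * c k) • y k) (y (k + 1))

end OneBit

namespace OneBit

/-! For `y` in the simplex, each `A_iᵀ y` is a weighted average of entries of `A`, so its modulus is
at most `maxRowNorm A < lam`. The push `lam / τ` away from zero therefore beats the gradient step,
and each modulus grows by at least `(lam - maxRowNorm A) / τ k` until capped at `1`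
(`min_le_abs_xUpdate`). As `γ ≤ 1/2`, `τ k` is `O(k)`; the increments dominate a divergent harmonic
series, so each entry has modulus exactly `1` from some index on. Limit points inherit this by
closedness. -/

theorem abs_sgn (t : ℝ) : |sgn t| = 1 := by
  unfold sgn; split_ifs <;> simp

theorem abs_entry_le_maxRowNorm {m n : ℕ} (A : Matrix (Fin m) (Fin n) ℝ) (l : Fin m) (j : Fin n) :
    |A l j| ≤ maxRowNorm A :=
  (le_ciSup (f := fun j => |A l j|) (Set.finite_range _).bddAbove j).trans
    (le_ciSup (f := fun l => ⨆ j, |A l j|) (Set.finite_range _).bddAbove l)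

theorem maxRowNorm_nonneg {m n : ℕ} (A : Matrix (Fin m) (Fin n) ℝ) : 0 ≤ maxRowNorm A :=
  Real.iSup_nonneg fun _ => Real.iSup_nonneg fun _ => abs_nonneg _

theorem abs_column_dot_le_maxRowNorm {m n : ℕ} (A : Matrix (Fin m) (Fin n) ℝ) {y : Fin m → ℝ}
    (hy : y ∈ stdSimplex ℝ (Fin m)) (i : Fin n) : |∑ l, A l i * y l| ≤ maxRowNorm A := by
  calc |∑ l, A l i * y l| ≤ ∑ l, |A l i * y l| := Finset.abs_sum_le_sum_abs _ _
    _ ≤ ∑ l, maxRowNorm A * y l := Finset.sum_le_sum fun l _ => by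
        rw [abs_mul, abs_of_nonneg (hy.1 l)]
        exact mul_le_mul_of_nonneg_right (abs_entry_le_maxRowNorm A l i) (hy.1 l)
    _ = maxRowNorm A := by rw [← Finset.mul_sum, hy.2, mul_one]

theorem abs_xUpdate {m n : ℕ} (A : Matrix (Fin m) (Fin n) ℝ) {lam τ : ℝ} (hlam : 0 ≤ lam)
    (hτ : 0 < τ) (x : Fin n → ℝ) (y : Fin m → ℝ) (i : Fin n) :
    |xUpdate A lam τ x y i| = min (|x i - (∑ l, A l i * y l) / τ| + lam / τ) 1 := by
  have h : 0 ≤ min (|x i - (∑ l, A l i * y l) / τ| + lam / τ) 1 := le_min (by positivity) zero_le_one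
  simp only [xUpdate, abs_mul, abs_sgn, one_mul, abs_of_nonneg h]

/-- While below `1`, the modulus of an entry of `x` grows by at least `(lam - maxRowNorm A) / τ`. -/
theorem min_le_abs_xUpdate {m n : ℕ} (A : Matrix (Fin m) (Fin n) ℝ) {lam τ : ℝ} (hlam : 0 ≤ lam)
    (hτ : 0 < τ) (x : Fin n → ℝ) {y : Fin m → ℝ} (hy : y ∈ stdSimplex ℝ (Fin m)) (i : Fin n) :
    min (|x i| + (lam - maxRowNorm A) / τ) 1 ≤ |xUpdate A lam τ x y i| := by
  rw [abs_xUpdate A hlam hτ]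
  refine min_le_min_right _ ?_
  have h1 := abs_sub_abs_le_abs_sub (x i) ((∑ l, A l i * y l) / τ)
  have h2 : |(∑ l, A l i * y l) / τ| ≤ maxRowNorm A / τ := by
    rw [abs_div, abs_of_pos hτ]
    exact div_le_div_of_nonneg_right (abs_column_dot_le_maxRowNorm A hy i) hτ.le
  rw [sub_div]
  linarith

/-- If the parameters `τ k` are positive and grow at most linearly, then every entry of `x k`
eventually has modulus `1`. -/
theorem IsAOSequence.eventually_abs_eq_one {m n : ℕ} {A : Matrix (Fin m) (Fin n) ℝ} {lam C : ℝ}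
    {τ ρ c : ℕ → ℝ} {x : ℕ → Fin n → ℝ} {y : ℕ → Fin m → ℝ} (h : IsAOSequence A lam τ ρ c x y)
    (hlam : maxRowNorm A < lam) (hτ : ∀ k, 1 ≤ k → 0 < τ k) (hC : ∀ k : ℕ, 1 ≤ k → τ k ≤ C * k)
    (i : Fin n) : ∀ᶠ k in atTop, |x k i| = 1 := by
  have hlam0 : 0 ≤ lam := (maxRowNorm_nonneg A).trans hlam.le
  have hCpos : 0 < C := by simpa using (hτ 1 le_rfl).trans_le (hC 1 le_rfl)
  have hd : 0 < lam - maxRowNorm A := sub_pos.2 hlam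
  -- The count starts at index `2`: `y 1` is arbitrary, and only projected iterates are known to lie
  -- in the simplex.
  have key : ∀ N : ℕ, min ((lam - maxRowNorm A) / (2 * C) *
      ∑ j ∈ Finset.range N, 1 / ((j : ℝ) + 1)) 1 ≤ |x (N + 2) i| := by
    intro N
    induction N with
    | zero => simp
    | succ N ih =>
      have hk : 1 ≤ N + 2 := by omega
      have hy : y (N + 2) ∈ stdSimplex ℝ (Fin m) := (h.y_step (N + 1) (by omega)).1
      have hstep := min_le_abs_xUpdate A hlam0 (hτ _ hk) (x (N + 2)) hy i
      rw [← h.x_step _ hk] at hstep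
      -- `N + 2 ≤ 2 * (N + 1)` aligns the bound with the harmonic term, whence the factor `2`.
      have hτle : τ (N + 2) ≤ 2 * C * ((N : ℝ) + 1) := by
        refine (hC _ hk).trans ?_
        push_cast
        nlinarith [mul_nonneg hCpos.le (Nat.cast_nonneg (α := ℝ) N)]
      have hinc : (lam - maxRowNorm A) / (2 * C) * (1 / ((N : ℝ) + 1)) ≤
          (lam - maxRowNorm A) / τ (N + 2) := by
        rw [div_mul_div_comm, mul_one]
        exact div_le_div_of_nonneg_left hd.le (hτ _ hk) hτle
      have hpos : 0 ≤ (lam - maxRowNorm A) / τ (N + 2) := (div_pos hd (hτ _ hk)).le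
      rw [Finset.sum_range_succ, mul_add]
      refine le_trans (le_min ?_ (min_le_right _ _)) hstep
      rcases min_le_iff.1 ih with h1 | h1
      · exact (min_le_left _ _).trans (add_le_add h1 hinc)
      -- Modulus `1`, once reached, is never lost.
      · exact (min_le_right _ _).trans (by linarith)
  have hlim : Tendsto (fun N : ℕ => (lam - maxRowNorm A) / (2 * C) *
      ∑ j ∈ Finset.range N, 1 / ((j : ℝ) + 1)) atTop atTop :=
    Real.tendsto_sum_range_one_div_nat_succ_atTop.const_mul_atTop (by positivity)
  obtain ⟨N₀, hN₀⟩ := eventually_atTop.1 (hlim.eventually_ge_atTop 1)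
  refine eventually_atTop.2 ⟨N₀ + 2, fun k hk => ?_⟩
  obtain ⟨N, rfl⟩ : ∃ N, k = N + 2 := ⟨k - 2, by omega⟩
  refine le_antisymm ?_ ?_
  · rw [h.x_step (N + 1) (by omega), abs_xUpdate A hlam0 (hτ _ (by omega))]
    exact min_le_right _ _
  · exact (min_eq_right (hN₀ N (by omega))).ge.trans (key N)

end OneBit

theorem corollary1 {m n : ℕ} (hm : 0 < m) (A : Matrix (Fin m) (Fin n) ℝ)
    (lam ρ γ β₁ β₂ β₃ : ℝ)
    (hβ₁ : 0 < β₁) (hβ₂ : 1 < β₂)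
    (hβ₃ : ρ * OneBit.specNorm A ^ 2 ≤ β₃) (hβ₃pos : 0 < β₃)
    (hρ : 0 < ρ) (hρ' : ρ ≤ 1 / β₁) (hγ : 0 < γ) (hγ' : γ ≤ 1 / 2)
    (τ ρs c : ℕ → ℝ)
    (hρs : ∀ k, 1 ≤ k → ρs k = ρ)
    (hc : ∀ k, 1 ≤ k → c k = β₁ / (k : ℝ) ^ γ)
    (hτ : ∀ k, 1 ≤ k → τ k = 16 * β₂ * OneBit.specNorm A ^ 2 / (ρ * c k ^ 2) + β₃)
    (hlam : OneBit.maxRowNorm A < lam)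
    (x : ℕ → Fin n → ℝ) (y : ℕ → Fin m → ℝ)
    (hxy : OneBit.IsAOSequence A lam τ ρs c x y)
    (xhat : Fin n → ℝ) (hxhat : MapClusterPt xhat atTop x) :
    ∀ i, xhat i ∈ ({-1, 1} : Set ℝ) := by
  intro i
  have hβ₂' : 0 < β₂ := zero_lt_one.trans hβ₂
  have hτpos : ∀ k, 1 ≤ k → 0 < τ k := fun k hk => by rw [hτ k hk]; positivity
  have hτle : ∀ k : ℕ, 1 ≤ k →
      τ k ≤ (16 * β₂ * OneBit.specNorm A ^ 2 / (ρ * β₁ ^ 2) + β₃) * k := by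
    intro k hk
    have hk1 : (1 : ℝ) ≤ k := by exact_mod_cast hk
    have hkγ : 0 < (k : ℝ) ^ γ := Real.rpow_pos_of_pos (by linarith) _
    -- The only use of `γ ≤ 1/2`: it makes `1 / c k ^ 2` grow at most linearly.
    have hpow : ((k : ℝ) ^ γ) ^ 2 ≤ k := by
      rw [← Real.rpow_mul_natCast (by linarith)]
      calc (k : ℝ) ^ (γ * (2 : ℕ)) ≤ (k : ℝ) ^ (1 : ℝ) :=
            Real.rpow_le_rpow_of_exponent_le hk1 (by push_cast; linarith)
        _ = k := Real.rpow_one _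
    have hrw : 16 * β₂ * OneBit.specNorm A ^ 2 / (ρ * (β₁ / (k : ℝ) ^ γ) ^ 2) =
        16 * β₂ * OneBit.specNorm A ^ 2 / (ρ * β₁ ^ 2) * ((k : ℝ) ^ γ) ^ 2 := by
      field_simp
    rw [hτ k hk, hc k hk, hrw, add_mul]
    exact add_le_add (mul_le_mul_of_nonneg_left hpow (by positivity))
      (le_mul_of_one_le_right hβ₃pos.le hk1)
  have hclosed : IsClosed {z : Fin n → ℝ | |z i| = 1} :=
    isClosed_eq (continuous_apply i).abs continuous_const
  have hmem : xhat ∈ {z : Fin n → ℝ | |z i| = 1} :=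
    hclosed.mem_of_mapClusterPt hxhat (hxy.eventually_abs_eq_one hlam hτpos hτle i)
  rcases (abs_eq zero_le_one).1 hmem with h | h <;> simp [h]
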